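/- Let $d\ge 1$ and let $\nu$ be a symmetric L\'evy measure on $\mathbb{R}^d$, i.e. a Borel measure with $\nu(\{0\})=0$, $\int_{\mathbb{R}^d}(1\wedge|y|^2)\,\nu(dy)<\infty$ and $\nu(-D)=\nu(D)$ for every Borel set $D$; assume also $\nu(\mathbb{R}^d)=\infty$. Put $$\Phi(\xi)=\int_{\mathbb{R}^d}\bigl(1-\cos\langle\xi,y\rangle\bigr)\,\nu(dy),\qquad \Psi(r)=\sup_{|\xi|\le r}\Phi(\xi),$$ $$\Psi^{-1}(s)=\sup\{r>0:\Psi(r)=s\},\qquad h(t)=\frac{1}{\Psi^{-1}(1/t)},$$ and let $\{P_t,\ t\ge 0\}$ be the convolution semigroup of probability measures on $\mathbb{R}^d$ with $\int e^{i\langle\xi,y\rangle}\,P_t(dy)=e^{-t\Phi(\xi)}$. Assume that there are constants $M_0>0$ and $t_p\in(0,\infty]$ such that $$\int_{\mathbb{R}^d}e^{-t\Phi(\xi)}|\xi|\,d\xi\le M_0\,h(t)^{-d-1},\qquad t\in(0,t_p),$$ and that there is $r_0>0$ such that the density $\frac{d\nu_c}{dm}$ (with respect to Lebesgue measure $m$)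 of the absolutely continuous part $\nu_c$ of $\nu$ satisfies $\inf_{0<|y|<r_0}\frac{d\nu_c}{dm}(y)>0$, the infimum being understood up to Lebesgue null sets. Then every $P_t$, $t>0$, has a continuous nonnegative density $p_t$ with respect to Lebesgue measure, and there exist positive constants $c_1,c_2,c_3,c_4$, independent of $t$ and $x$, such that $$p_t(x)\ge c_1\exp\Bigl(-c_2|x|\log\Bigl(\frac{c_3|x|}{t}\Bigr)\Bigr)$$ for all $t\in(0,t_p)$ and all $x\in\mathbb{R}^d$ with $|x|\ge\max\{r_0,c_4t\}$. -/

import Mathlib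

open MeasureTheory
open scoped Pointwise ENNReal

noncomputable section

namespace LevyDensity

/-- A symmetric Lévy measure on `ℝᵈ`: no mass at the origin, `∫ (1 ∧ |y|²) ν(dy) < ∞`, and
`ν (-D) = ν D` for every Borel set `D`. -/
structure IsSymmetricLevyMeasure {d : ℕ} (ν : Measure (EuclideanSpace ℝ (Fin d))) : Prop where
  zero : ν {0} = 0
  lintegral_lt_top : ∫⁻ y, ENNReal.ofReal (min 1 (‖y‖ ^ 2)) ∂ν < ∞
  symm : ∀ D : Set (EuclideanSpace ℝ (Fin d)), MeasurableSet D → ν (-D) = ν D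

/-- The characteristic exponent `Φ(ξ) = ∫ (1 - cos ⟨ξ, y⟩) ν(dy)`. -/
def Phi {d : ℕ} (ν : Measure (EuclideanSpace ℝ (Fin d))) (ξ : EuclideanSpace ℝ (Fin d)) : ℝ :=
  ∫ y, (1 - Real.cos (inner ℝ ξ y)) ∂ν

/-- `Ψ(r) = sup_{|ξ| ≤ r} Φ(ξ)`. -/
def Psi {d : ℕ} (ν : Measure (EuclideanSpace ℝ (Fin d))) (r : ℝ) : ℝ :=
  sSup (Phi ν '' {ξ | ‖ξ‖ ≤ r})

/-- The generalized inverse `Ψ⁻¹(s) = sup {r > 0 : Ψ(r) = s}`. -/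
def PsiInv {d : ℕ} (ν : Measure (EuclideanSpace ℝ (Fin d))) (s : ℝ) : ℝ :=
  sSup {r : ℝ | 0 < r ∧ Psi ν r = s}

/-- `h(t) = 1 / Ψ⁻¹(1 / t)`. -/
def h {d : ℕ} (ν : Measure (EuclideanSpace ℝ (Fin d))) (t : ℝ) : ℝ :=
  1 / PsiInv ν (1 / t)

/-- `∫ exp (-t Φ(ξ)) |ξ| dξ ≤ M₀ h(t)^(-d-1)` for all `t ∈ (0, t_p)`, where `M₀ > 0` and
`t_p ∈ (0, ∞]`. (The integral is a Lebesgue integral in `[0, ∞]`, so it is claimed to be finite.) -/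
def ExponentIntegralCondition {d : ℕ} (ν : Measure (EuclideanSpace ℝ (Fin d)))
    (M₀ : ℝ) (tp : ℝ≥0∞) : Prop :=
  0 < M₀ ∧ 0 < tp ∧ ∀ t : ℝ, 0 < t → ENNReal.ofReal t < tp →
    ∫⁻ ξ : EuclideanSpace ℝ (Fin d), ENNReal.ofReal (Real.exp (-t * Phi ν ξ) * ‖ξ‖)
      ≤ ENNReal.ofReal (M₀ * (h ν t) ^ (-(d : ℤ) - 1))

/-- `P t`, `t ≥ 0`, is the convolution semigroup of probability measures with Fourier transform
`exp (-t Φ)`. The Fourier transform determines each `P t`, hence also gives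
`P (s + t) = P s ∗ P t` and `P 0 = δ₀`. -/
def IsLevySemigroup {d : ℕ} (ν : Measure (EuclideanSpace ℝ (Fin d)))
    (P : ℝ → Measure (EuclideanSpace ℝ (Fin d))) : Prop :=
  ∀ t : ℝ, 0 ≤ t → IsProbabilityMeasure (P t) ∧
    ∀ ξ : EuclideanSpace ℝ (Fin d), charFun (P t) ξ = Complex.exp (-(t : ℂ) * (Phi ν ξ : ℂ))

/-- `p t` is, for every `t > 0`, the continuous nonnegative density of `P t` with respect to
Lebesgue measure (there is at most one). -/
def IsTransitionDensity {d : ℕ} (P : ℝ → Measure (EuclideanSpace ℝ (Fin d)))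
    (p : ℝ → EuclideanSpace ℝ (Fin d) → ℝ) : Prop :=
  ∀ t : ℝ, 0 < t → Continuous (p t) ∧ (∀ x, 0 ≤ p t x) ∧
    P t = (volume : Measure (EuclideanSpace ℝ (Fin d))).withDensity
      (fun x => ENNReal.ofReal (p t x))

end LevyDensity

end

/-! The density exists by Fourier inversion: finiteness of `∫ e^{-tΦ}|ξ|` at one small time makes
the characteristic function of every `P t`, `t > 0`, integrable.

The lower bound comes from chaining small jumps. In a short time `s`, the process makes one jump
into a ball `B(v, 2ρ)`, `r₀/4 ≤ |v| ≤ r₀/2`, with probability of order `s`, because `ν` dominates a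
multiple of Lebesgue measure there. The remaining jumps move it by less than `ρ` with probability at
least `1/2`. Hence `P s ≥ c s · Leb` on `B(v, ρ)` (`exists_smul_restrict_ball_le`), first for
compound Poisson laws of truncated `ν`, with constants free of the truncation, then for `P s` by
weak convergence.

To reach `x` at time `t`, take `N` equal steps `x/N` in times `t/N`, with `N` comparable to
`|x|/r₀`. Convolving the one-step bounds (`IsLevySemigroup.smul_restrict_ball_le`) gives a density
of at least `q⁻¹ (c q t/N)^N` near `x`, which is the stated exponential of `-|x| log(|x|/t)`. -/

namespace LevyDensity

section

open Filter Topology FourierTransform SchwartzMap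

/-! ### Fourier inversion: a continuous density from an integrable characteristic function -/

section Density

variable {E : Type*} [NormedAddCommGroup E] [InnerProductSpace ℝ E] [FiniteDimensional ℝ E]
  [MeasurableSpace E] [BorelSpace E]

theorem measure_ext_of_integral_contDiff {μ ν : Measure E} [IsFiniteMeasureOnCompacts μ]
    [IsFiniteMeasureOnCompacts ν]
    (hμν : ∀ g : E → ℝ, ContDiff ℝ (⊤ : ℕ∞) g → HasCompactSupport g →
      ∫ x, g x ∂μ = ∫ x, g x ∂ν) : μ = ν := by
  refine Measure.ext_of_integral_eq_on_compactlySupported fun f ↦ ?_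
  have hε : ∀ n : ℕ, (0 : ℝ) < 1 / ((n : ℝ) + 1) := fun n ↦ by positivity
  choose g hg hgf hgs using fun n : ℕ ↦ f.continuous.exists_contDiff_approx (⊤ : ℕ∞)
    (ε := fun _ ↦ 1 / ((n : ℝ) + 1)) continuous_const (fun _ ↦ hε n)
  change ∀ (n : ℕ) (x : E), dist (g n x) (f x) < 1 / ((n : ℝ) + 1) at hgf
  have hK : IsCompact (tsupport f) := f.hasCompactSupport
  have hgK : ∀ n, HasCompactSupport (g n) := fun n ↦
    HasCompactSupport.of_support_subset_isCompact hK ((hgs n).trans (subset_tsupport _))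
  have key : ∀ ρ : Measure E, IsFiniteMeasureOnCompacts ρ →
      Tendsto (fun n ↦ ∫ x, g n x ∂ρ) atTop (𝓝 (∫ x, f x ∂ρ)) := by
    intro ρ hρ
    refine tendsto_integral_of_dominated_convergence
      ((tsupport f).indicator fun x ↦ ‖f x‖ + 1) (fun n ↦ (hg n).continuous.aestronglyMeasurable)
      ?_ (fun n ↦ ae_of_all _ fun x ↦ ?_) (ae_of_all _ fun x ↦ ?_)
    · rw [integrable_indicator_iff hK.measurableSet]
      exact ContinuousOn.integrableOn_compact hK (by fun_prop)
    · by_cases hx : x ∈ tsupport f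
      · rw [Set.indicator_of_mem hx]
        have h1 := (hgf n x).le
        rw [dist_eq_norm] at h1
        have h2 : 1 / ((n : ℝ) + 1) ≤ 1 := by
          rw [div_le_one (by positivity)]; linarith [(Nat.cast_nonneg n : (0 : ℝ) ≤ n)]
        have h3 := norm_add_le (g n x - f x) (f x)
        rw [sub_add_cancel] at h3
        linarith
      · rw [Set.indicator_of_notMem hx]
        have : g n x = 0 := by
          by_contra h
          exact hx (subset_tsupport _ (hgs n h))
        simp [this]
    · rw [tendsto_iff_dist_tendsto_zero]
      exact squeeze_zero (fun _ ↦ dist_nonneg) (fun n ↦ (hgf n x).le)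
        tendsto_one_div_add_atTop_nhds_zero_nat
  refine tendsto_nhds_unique (key μ inferInstance) ?_
  simp_rw [fun n ↦ hμν (g n) (hg n) (hgK n)]
  exact key ν inferInstance

/-- Fubini for Fourier integrals, used twice: once to pass from `P` to its characteristic function,
once to return to `g`. The factor `-(2π)` reconciles the kernel `e^{i⟨x,ξ⟩}` of `charFun` with the
kernel `e^{-2πi⟨x,ξ⟩}` of `𝓕`. -/
theorem integral_schwartz_eq_integral_mul_fourierInv_charFun {P : Measure E} [IsFiniteMeasure P]
    (hP : Integrable (charFun P)) (g : 𝓢(E, ℂ)) :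
    ∫ x, g x ∂P = ∫ x, g x * 𝓕⁻ (fun ξ ↦ charFun P (-(2 * Real.pi) • ξ)) x := by
  have hL : Continuous fun p : E × E ↦ (innerₗ E) p.1 p.2 := by
    simpa using continuous_inner
  have hint : Integrable (fun ξ ↦ charFun P (-(2 * Real.pi) • ξ)) :=
    hP.comp_smul (by simp [Real.pi_ne_zero])
  have h1 := VectorFourier.integral_fourierIntegral_smul_eq_flip (μ := (volume : Measure E))
    (ν := P) (e := Real.fourierChar) (L := innerₗ E) (f := (𝓕⁻ g : 𝓢(E, ℂ)))
    (g := fun _ ↦ (1 : ℂ))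
    Real.continuous_fourierChar hL (SchwartzMap.integrable _) (integrable_const _)
  have h2 : ∀ x, VectorFourier.fourierIntegral Real.fourierChar volume (innerₗ E)
      (𝓕⁻ g : 𝓢(E, ℂ)) x = g x := by
    intro x
    have : (𝓕 (𝓕⁻ g) : 𝓢(E, ℂ)) x = g x := by simp
    rw [SchwartzMap.fourier_coe] at this
    exact this
  have h3 : ∀ x, VectorFourier.fourierIntegral Real.fourierChar P (innerₗ E).flip
      (fun _ ↦ (1 : ℂ)) x = charFun P (-(2 * Real.pi) • x) := by
    intro x
    rw [charFun_eq_fourierIntegral', flip_innerₗ, smul_smul]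
    have : -(2 * Real.pi)⁻¹ * -(2 * Real.pi) = 1 := by
      field_simp
    rw [this, one_smul]; rfl
  simp_rw [h2, h3, smul_eq_mul, mul_one] at h1
  rw [h1]
  have h4 := VectorFourier.integral_fourierIntegral_smul_eq_flip (μ := (volume : Measure E))
    (ν := (volume : Measure E)) (e := Real.fourierChar) (L := -innerₗ E) (f := g)
    (g := fun ξ ↦ charFun P (-(2 * Real.pi) • ξ))
    Real.continuous_fourierChar continuous_inner.neg (SchwartzMap.integrable _) hint
  have h5 : ∀ x, VectorFourier.fourierIntegral Real.fourierChar volume (-innerₗ E) g x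
      = (𝓕⁻ g : 𝓢(E, ℂ)) x := by
    intro x
    rw [SchwartzMap.fourierInv_coe]; rfl
  simp_rw [h5, smul_eq_mul] at h4
  rw [h4]
  have h6 : (-innerₗ E).flip = -innerₗ E := by
    ext x y
    simp [real_inner_comm]
  rw [h6]
  rfl

theorem exists_continuous_density_of_integrable_charFun (P : Measure E) [IsFiniteMeasure P]
    (hP : Integrable (charFun P)) :
    ∃ p : E → ℝ, Continuous p ∧ (∀ x, 0 ≤ p x) ∧
      P = volume.withDensity fun x ↦ ENNReal.ofReal (p x) := by
  set q : E → ℂ := 𝓕⁻ (fun ξ ↦ charFun P (-(2 * Real.pi) • ξ)) with hq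
  have hint : Integrable (fun ξ ↦ charFun P (-(2 * Real.pi) • ξ)) :=
    hP.comp_smul (by simp [Real.pi_ne_zero])
  have hqc : Continuous q := by
    refine VectorFourier.fourierIntegral_continuous Real.continuous_fourierChar ?_ hint
    exact continuous_inner.neg
  have hpc : Continuous fun x ↦ (q x).re := Complex.continuous_re.comp hqc
  have key : ∀ g : E → ℝ, ContDiff ℝ (⊤ : ℕ∞) g → HasCompactSupport g →
      ∫ x, g x ∂P = ∫ x, g x * (q x).re := by
    intro g hg hgc
    have hg₁ : HasCompactSupport (Complex.ofRealCLM ∘ g) := hgc.comp_left rfl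
    have hg₂ : ContDiff ℝ (⊤ : ℕ∞) (Complex.ofRealCLM ∘ g) := by fun_prop
    have h := integral_schwartz_eq_integral_mul_fourierInv_charFun hP (hg₁.toSchwartzMap hg₂)
    simp only [HasCompactSupport.toSchwartzMap_toFun, Function.comp_apply,
      Complex.ofRealCLM_apply] at h
    rw [integral_complex_ofReal, ← hq] at h
    have h' := congrArg Complex.re h
    rw [Complex.ofReal_re] at h'
    have hi : Integrable (fun x ↦ (g x : ℂ) * q x) := by
      refine Continuous.integrable_of_hasCompactSupport (by have := hg.continuous; fun_prop) ?_
      exact HasCompactSupport.mul_right hg₁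
    rw [h', ← RCLike.re_eq_complex_re, ← integral_re hi]
    simp
  -- If the density were negative at a point, a bump supported where it is negative would have a
  -- negative integral against `P`.
  have hnn : ∀ x, 0 ≤ (q x).re := by
    intro x₀
    by_contra! hneg
    obtain ⟨δ, hδ, hball⟩ := Metric.isOpen_iff.1 (isOpen_lt hpc continuous_const) x₀ hneg
    let b : ContDiffBump x₀ := ⟨δ / 2, δ, by positivity, by linarith⟩
    have h1 := key b b.contDiff b.hasCompactSupport
    have h2 : 0 ≤ ∫ x, b x ∂P := integral_nonneg fun x ↦ b.nonneg
    have h3 : 0 < ∫ x, -(b x * (q x).re) := by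
      refine Continuous.integral_pos_of_hasCompactSupport_nonneg_nonzero (x := x₀)
        (by have := b.continuous; fun_prop) ?_ ?_ ?_
      · exact (HasCompactSupport.mul_right b.hasCompactSupport).neg
      · intro x
        by_cases hx : x ∈ Metric.ball x₀ δ
        · have := hball hx
          have h0 : 0 ≤ b x := b.nonneg
          simp only [Set.mem_ofPred_eq] at this
          simp only [Pi.zero_apply]
          nlinarith
        · have : b x = 0 := b.zero_of_le_dist (by simpa using hx)
          simp [this]
      · have : b x₀ = 1 := b.one_of_mem_closedBall (by simp [b.rIn_pos.le])
        simp [this, hneg.ne]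
    rw [integral_neg] at h3
    linarith
  refine ⟨fun x ↦ (q x).re, hpc, hnn, ?_⟩
  have hfin : IsLocallyFiniteMeasure (volume.withDensity fun x ↦ ENNReal.ofReal (q x).re) :=
    IsLocallyFiniteMeasure.withDensity_ofReal hpc
  refine measure_ext_of_integral_contDiff fun g hg hgc ↦ ?_
  rw [key g hg hgc, integral_withDensity_eq_integral_toReal_smul (by fun_prop)
    (ae_of_all _ fun x ↦ ENNReal.ofReal_lt_top)]
  refine integral_congr_ae (ae_of_all _ fun x ↦ ?_)
  simp [ENNReal.toReal_ofReal (hnn x), mul_comm]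

end Density

/-! ### Compound Poisson laws -/

section CompoundPoisson

variable {E : Type*} [NormedAddCommGroup E] [InnerProductSpace ℝ E] [FiniteDimensional ℝ E]
  [MeasurableSpace E] [BorelSpace E]

theorem conv_univ (μ ν : Measure E) [SFinite μ] [SFinite ν] :
    (Measure.conv μ ν) Set.univ = μ Set.univ * ν Set.univ := by
  rw [Measure.conv, Measure.map_apply (by fun_prop) MeasurableSet.univ, Set.preimage_univ,
    ← Set.univ_prod_univ, Measure.prod_prod]

theorem conv_apply (μ ν : Measure E) [SFinite μ] [SFinite ν] {s : Set E} (hs : MeasurableSet s) :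
    (Measure.conv μ ν) s = ∫⁻ x, ν {y | x + y ∈ s} ∂μ := by
  rw [Measure.conv, Measure.map_apply (by fun_prop) hs,
    Measure.prod_apply (measurableSet_preimage (by fun_prop) hs)]
  rfl

theorem conv_mono {μ μ' ν ν' : Measure E} [SFinite μ] [SFinite μ'] [SFinite ν] [SFinite ν']
    (h₁ : μ ≤ μ') (h₂ : ν ≤ ν') : Measure.conv μ ν ≤ Measure.conv μ' ν' :=
  Measure.map_mono (Measure.prod_mono h₁ h₂) (by fun_prop)

/-- The `n`-fold convolution power of a measure. -/
noncomputable def convPow (μ : Measure E) : ℕ → Measure E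
  | 0 => Measure.dirac 0
  | n + 1 => Measure.conv (convPow μ n) μ

instance isFiniteMeasure_convPow (μ : Measure E) [IsFiniteMeasure μ] (n : ℕ) :
    IsFiniteMeasure (convPow μ n) := by
  induction n with
  | zero => exact inferInstanceAs (IsFiniteMeasure (Measure.dirac 0))
  | succ n ih => exact inferInstanceAs (IsFiniteMeasure (Measure.conv (convPow μ n) μ))

theorem convPow_univ (μ : Measure E) [IsFiniteMeasure μ] (n : ℕ) :
    convPow μ n Set.univ = μ Set.univ ^ n := by
  induction n with
  | zero => simp [convPow]
  | succ n ih => rw [convPow, conv_univ, ih, pow_succ]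

theorem charFun_convPow (μ : Measure E) [IsFiniteMeasure μ] (n : ℕ) (ξ : E) :
    charFun (convPow μ n) ξ = charFun μ ξ ^ n := by
  induction n with
  | zero => simp [convPow]
  | succ n ih => rw [convPow, charFun_conv, ih, pow_succ]

theorem convPow_one (μ : Measure E) [IsFiniteMeasure μ] : convPow μ 1 = μ := by
  rw [convPow, convPow, Measure.dirac_zero_conv]

/-- The compound Poisson distribution with finite Lévy measure `μ`. -/
noncomputable def compoundPoisson (μ : Measure E) : Measure E :=
  Measure.sum fun n : ℕ ↦
    ENNReal.ofReal (Real.exp (-μ.real Set.univ) / n.factorial) • convPow μ n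

theorem hasSum_exp_div_factorial (z : ℂ) (a : ℝ) :
    HasSum (fun n : ℕ ↦ ((Real.exp (-a) / n.factorial : ℝ) : ℂ) * z ^ n) (Complex.exp (z - a)) := by
  have h := (NormedSpace.expSeries_div_hasSum_exp z).mul_left (Complex.exp (-a))
  rw [← Complex.exp_eq_exp_ℂ, ← Complex.exp_add, neg_add_eq_sub] at h
  convert! h using 2 with n
  push_cast
  ring

instance isProbabilityMeasure_compoundPoisson (μ : Measure E) [IsFiniteMeasure μ] :
    IsProbabilityMeasure (compoundPoisson μ) := by
  constructor
  rw [compoundPoisson, Measure.sum_apply _ MeasurableSet.univ]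
  set a := μ.real Set.univ with ha
  have h1 : ∀ n : ℕ, (ENNReal.ofReal (Real.exp (-a) / n.factorial) • convPow μ n) Set.univ
      = ENNReal.ofReal (Real.exp (-a) / n.factorial * a ^ n) := by
    intro n
    rw [Measure.smul_apply, convPow_univ, smul_eq_mul, ENNReal.ofReal_mul (by positivity),
      ENNReal.ofReal_pow measureReal_nonneg, ha, ofReal_measureReal]
  simp_rw [h1]
  have h2 := hasSum_exp_div_factorial (a : ℂ) a
  rw [sub_self, Complex.exp_zero] at h2
  have h3 : HasSum (fun n : ℕ ↦ Real.exp (-a) / n.factorial * a ^ n) 1 := by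
    rw [← Complex.hasSum_ofReal]
    simpa using h2
  rw [← ENNReal.ofReal_tsum_of_nonneg (fun n ↦ by positivity) h3.summable, h3.tsum_eq,
    ENNReal.ofReal_one]

theorem charFun_compoundPoisson (μ : Measure E) [IsFiniteMeasure μ] (ξ : E) :
    charFun (compoundPoisson μ) ξ = Complex.exp (charFun μ ξ - (μ.real Set.univ : ℝ)) := by
  have hint : Integrable (fun x : E ↦ Complex.exp (inner ℝ x ξ * Complex.I))
      (compoundPoisson μ) := by
    refine Integrable.of_bound (by fun_prop) 1 (ae_of_all _ fun x ↦ ?_)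
    rw [Complex.norm_exp_ofReal_mul_I]
  rw [charFun_apply]
  unfold compoundPoisson at hint ⊢
  have h := hasSum_integral_measure hint
  refine h.unique ?_
  convert! hasSum_exp_div_factorial (charFun μ ξ) (μ.real Set.univ) using 2 with n
  rw [integral_smul_measure, ← charFun_convPow, charFun_apply,
    ENNReal.toReal_ofReal (by positivity), Complex.real_smul]

theorem charFun_add_measure (μ ν : Measure E) [IsFiniteMeasure μ] [IsFiniteMeasure ν] (ξ : E) :
    charFun (μ + ν) ξ = charFun μ ξ + charFun ν ξ := by
  simp_rw [charFun_apply]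
  refine integral_add_measure ?_ ?_ <;>
  · refine Integrable.of_bound (by fun_prop) 1 (ae_of_all _ fun x ↦ ?_)
    rw [Complex.norm_exp_ofReal_mul_I]

theorem compoundPoisson_add (μ ν : Measure E) [IsFiniteMeasure μ] [IsFiniteMeasure ν] :
    compoundPoisson (μ + ν) = Measure.conv (compoundPoisson μ) (compoundPoisson ν) := by
  refine Measure.ext_of_charFun (funext fun ξ ↦ ?_)
  rw [charFun_conv, charFun_compoundPoisson, charFun_compoundPoisson, charFun_compoundPoisson,
    ← Complex.exp_add, measureReal_add_apply,
    charFun_add_measure]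
  push_cast
  ring_nf

/-- The one-jump term of the series. -/
theorem smul_le_compoundPoisson (μ : Measure E) [IsFiniteMeasure μ] :
    ENNReal.ofReal (Real.exp (-μ.real Set.univ)) • μ ≤ compoundPoisson μ := by
  have h := Measure.le_sum (fun n : ℕ ↦
    ENNReal.ofReal (Real.exp (-μ.real Set.univ) / n.factorial) • convPow μ n) 1
  simp only [convPow_one, Nat.factorial_one, Nat.cast_one, div_one] at h
  exact h

/-- A probability measure whose characteristic function is uniformly close to `1` on a ball is
mostly concentrated near the origin. -/
theorem half_le_measure_ball_of_charFun {ρ : ℝ} (hρ : 0 < ρ) :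
    ∃ R > 0, ∃ ε > 0, ∀ Q : Measure E, IsProbabilityMeasure Q →
      (∀ ξ, ‖ξ‖ ≤ R → ‖1 - charFun Q ξ‖ ≤ ε) → 2⁻¹ ≤ Q (Metric.ball 0 ρ) := by
  let b := stdOrthonormalBasis ℝ E
  set N : ℝ := (Module.finrank ℝ E : ℝ) with hN
  have hN0 : 0 ≤ N := Nat.cast_nonneg _
  -- If all `N` coordinates are at most `r`, the norm is at most `N r < ρ`; each coordinate exceeds
  -- `r` with probability at most `1/(2(N+1))`, so the union bound stays below `1/2`.
  set r : ℝ := ρ / (2 * (N + 1)) with hr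
  have hr0 : 0 < r := by positivity
  refine ⟨2 * r⁻¹, by positivity, 1 / (4 * (N + 1)), by positivity, fun Q hQ h ↦ ?_⟩
  have h1 : ∀ i, Q.real {x | r < |inner ℝ (b i) x|} ≤ 1 / (2 * (N + 1)) := by
    intro i
    refine (measureReal_abs_inner_gt_le_integral_charFun hr0).trans ?_
    have h2 := intervalIntegral.norm_integral_le_of_norm_le_const (a := -2 * r⁻¹) (b := 2 * r⁻¹)
      (f := fun t : ℝ ↦ 1 - charFun Q (t • b i)) (C := 1 / (4 * (N + 1))) (fun t ht ↦ h _ ?_)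
    · calc 2⁻¹ * r * ‖∫ t in -2 * r⁻¹..2 * r⁻¹, 1 - charFun Q (t • b i)‖
          ≤ 2⁻¹ * r * (1 / (4 * (N + 1)) * |2 * r⁻¹ - -2 * r⁻¹|) := by gcongr
        _ = 1 / (2 * (N + 1)) := by
          rw [abs_of_pos (by ring_nf; positivity)]
          field_simp
          ring
    · rw [norm_smul, b.norm_eq_one, mul_one, Real.norm_eq_abs, abs_le]
      have h0 : -2 * r⁻¹ ≤ 2 * r⁻¹ := by nlinarith [inv_pos.2 hr0]
      rw [Set.uIoc_of_le h0] at ht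
      constructor <;> linarith [ht.1, ht.2]
  have hsub : (Metric.ball (0 : E) ρ)ᶜ ⊆ ⋃ i, {x | r < |inner ℝ (b i) x|} := by
    intro x hx
    by_contra hx'
    simp only [Set.mem_iUnion, Set.mem_ofPred_eq, not_exists, not_lt] at hx'
    apply hx
    rw [mem_ball_zero_iff]
    calc ‖x‖ = ‖∑ i, inner ℝ (b i) x • b i‖ := by rw [b.sum_repr']
      _ ≤ ∑ i, ‖inner ℝ (b i) x • b i‖ := norm_sum_le _ _
      _ ≤ ∑ _i : Fin (Module.finrank ℝ E), r := by
          refine Finset.sum_le_sum fun i _ ↦ ?_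
          rw [norm_smul, b.norm_eq_one, mul_one]
          exact hx' i
      _ = N * r := by simp [hN]
      _ < ρ := by
          rw [hr, mul_div_assoc', div_lt_iff₀ (by positivity)]
          nlinarith
  have h3 : Q.real (Metric.ball (0 : E) ρ)ᶜ ≤ 1 / 2 := by
    calc Q.real (Metric.ball (0 : E) ρ)ᶜ ≤ Q.real (⋃ i, {x | r < |inner ℝ (b i) x|}) :=
          measureReal_mono hsub
      _ ≤ ∑ i, Q.real {x | r < |inner ℝ (b i) x|} := measureReal_iUnion_fintype_le _
      _ ≤ ∑ _i : Fin (Module.finrank ℝ E), 1 / (2 * (N + 1)) := Finset.sum_le_sum fun i _ ↦ h1 i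
      _ = N * (1 / (2 * (N + 1))) := by simp [hN]
      _ ≤ 1 / 2 := by
          rw [mul_one_div, div_le_div_iff₀ (by positivity) (by positivity)]
          linarith
  rw [measureReal_compl measurableSet_ball, probReal_univ] at h3
  have h4 : (2⁻¹ : ℝ) ≤ Q.real (Metric.ball (0 : E) ρ) := by linarith
  have := ENNReal.ofReal_le_ofReal h4
  rwa [ofReal_measureReal, ENNReal.ofReal_inv_of_pos (by norm_num), ENNReal.ofReal_ofNat] at this

end CompoundPoisson

/-! ### The exponent `Φ` and the truncated Lévy measures -/

section Exponent

variable {d : ℕ} {ν : Measure (EuclideanSpace ℝ (Fin d))}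

theorem one_sub_cos_inner_le (ξ y : EuclideanSpace ℝ (Fin d)) :
    1 - Real.cos (inner ℝ ξ y) ≤ (2 + ‖ξ‖ ^ 2) * min 1 (‖y‖ ^ 2) := by
  have h0 := sq_nonneg ‖ξ‖
  rcases le_total 1 (‖y‖ ^ 2) with h | h
  · rw [min_eq_left h]
    linarith [Real.neg_one_le_cos (inner ℝ ξ y)]
  · rw [min_eq_right h]
    have h1 := Real.one_sub_sq_div_two_le_cos (x := inner ℝ ξ y)
    have h2 : (inner ℝ ξ y : ℝ) ^ 2 ≤ (‖ξ‖ * ‖y‖) ^ 2 := by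
      rw [sq_le_sq, abs_of_nonneg (by positivity : 0 ≤ ‖ξ‖ * ‖y‖)]
      exact abs_real_inner_le_norm ξ y
    rw [mul_pow] at h2
    nlinarith [mul_nonneg h0 (sq_nonneg ‖y‖), sq_nonneg ‖y‖]

theorem one_sub_cos_nonneg (a : ℝ) : 0 ≤ 1 - Real.cos a := by
  linarith [Real.cos_le_one a]

theorem IsSymmetricLevyMeasure.integrable_min (hν : IsSymmetricLevyMeasure ν) :
    Integrable (fun y ↦ min 1 (‖y‖ ^ 2)) ν := by
  refine ⟨by fun_prop, ?_⟩
  rw [hasFiniteIntegral_iff_ofReal (ae_of_all _ fun y ↦ by positivity)]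
  exact hν.lintegral_lt_top

theorem IsSymmetricLevyMeasure.integrable_one_sub_cos (hν : IsSymmetricLevyMeasure ν)
    (ξ : EuclideanSpace ℝ (Fin d)) : Integrable (fun y ↦ 1 - Real.cos (inner ℝ ξ y)) ν := by
  refine (hν.integrable_min.const_mul (2 + ‖ξ‖ ^ 2)).mono' (by fun_prop)
    (ae_of_all _ fun y ↦ ?_)
  rw [Real.norm_of_nonneg (one_sub_cos_nonneg _)]
  exact one_sub_cos_inner_le ξ y

theorem Phi_nonneg (ν : Measure (EuclideanSpace ℝ (Fin d))) (ξ : EuclideanSpace ℝ (Fin d)) :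
    0 ≤ Phi ν ξ :=
  integral_nonneg fun _ ↦ one_sub_cos_nonneg _

theorem IsSymmetricLevyMeasure.Phi_le (hν : IsSymmetricLevyMeasure ν)
    (ξ : EuclideanSpace ℝ (Fin d)) :
    Phi ν ξ ≤ (2 + ‖ξ‖ ^ 2) * ∫ y, min 1 (‖y‖ ^ 2) ∂ν := by
  rw [← integral_const_mul]
  exact integral_mono (hν.integrable_one_sub_cos ξ) (hν.integrable_min.const_mul _)
    fun y ↦ one_sub_cos_inner_le ξ y

/-- The restriction of `ν` to the jumps of size larger than `1 / (k + 1)`. -/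
noncomputable def truncation (ν : Measure (EuclideanSpace ℝ (Fin d))) (k : ℕ) :
    Measure (EuclideanSpace ℝ (Fin d)) :=
  ν.restrict {y | 1 / ((k : ℝ) + 1) < ‖y‖}

theorem measurableSet_truncation (k : ℕ) :
    MeasurableSet {y : EuclideanSpace ℝ (Fin d) | 1 / ((k : ℝ) + 1) < ‖y‖} :=
  measurableSet_lt measurable_const measurable_norm

theorem IsSymmetricLevyMeasure.isFiniteMeasure_truncation (hν : IsSymmetricLevyMeasure ν) (k : ℕ) :
    IsFiniteMeasure (truncation ν k) := by
  constructor
  rw [truncation, Measure.restrict_apply_univ]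
  set a : ℝ := (1 / ((k : ℝ) + 1)) ^ 2 with ha
  have ha0 : 0 < a := by positivity
  have ha1 : a ≤ 1 := by
    refine pow_le_one₀ (by positivity) ?_
    rw [div_le_one (by positivity)]
    linarith [(Nat.cast_nonneg k : (0 : ℝ) ≤ k)]
  calc ν {y | 1 / ((k : ℝ) + 1) < ‖y‖}
      ≤ ν {y | ENNReal.ofReal a ≤ ENNReal.ofReal (min 1 (‖y‖ ^ 2))} := by
        refine measure_mono fun y hy ↦ ENNReal.ofReal_le_ofReal (le_min ha1 ?_)
        exact pow_le_pow_left₀ (by positivity) (le_of_lt hy) 2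
    _ ≤ (∫⁻ y, ENNReal.ofReal (min 1 (‖y‖ ^ 2)) ∂ν) / ENNReal.ofReal a :=
        meas_ge_le_lintegral_div (by fun_prop) (by simpa using ha0) ENNReal.ofReal_ne_top
    _ < ∞ := ENNReal.div_lt_top hν.lintegral_lt_top.ne (by simpa using ha0)

theorem IsSymmetricLevyMeasure.Phi_truncation_le (hν : IsSymmetricLevyMeasure ν) (k : ℕ)
    (ξ : EuclideanSpace ℝ (Fin d)) : Phi (truncation ν k) ξ ≤ Phi ν ξ :=
  setIntegral_le_integral (hν.integrable_one_sub_cos ξ) (ae_of_all _ fun _ ↦ one_sub_cos_nonneg _)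

theorem IsSymmetricLevyMeasure.tendsto_Phi_truncation (hν : IsSymmetricLevyMeasure ν)
    (ξ : EuclideanSpace ℝ (Fin d)) :
    Tendsto (fun k ↦ Phi (truncation ν k) ξ) atTop (𝓝 (Phi ν ξ)) := by
  have h := tendsto_setIntegral_of_monotone (μ := ν)
    (s := fun k : ℕ ↦ {y : EuclideanSpace ℝ (Fin d) | 1 / ((k : ℝ) + 1) < ‖y‖})
    (f := fun y ↦ 1 - Real.cos (inner ℝ ξ y)) measurableSet_truncation
    (fun i j hij y (hy : 1 / ((i : ℝ) + 1) < ‖y‖) ↦ lt_of_le_of_lt (Nat.one_div_le_one_div hij) hy)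
    (hν.integrable_one_sub_cos ξ).integrableOn
  rw [setIntegral_eq_integral_of_forall_compl_eq_zero] at h
  · exact h
  · intro y hy
    have : y = 0 := by
      by_contra h0
      obtain ⟨n, hn⟩ := exists_nat_one_div_lt (norm_pos_iff.2 h0)
      exact hy (Set.mem_iUnion.2 ⟨n, hn⟩)
    simp [this]

/-- Symmetry makes the characteristic function real, so only the cosine part survives. -/
theorem IsSymmetricLevyMeasure.charFun_truncation (hν : IsSymmetricLevyMeasure ν) (k : ℕ)
    (ξ : EuclideanSpace ℝ (Fin d)) :
    charFun (truncation ν k) ξ - ((truncation ν k).real Set.univ : ℝ)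
      = -(Phi (truncation ν k) ξ : ℂ) := by
  have := hν.isFiniteMeasure_truncation k
  have hneg : (truncation ν k).map (fun y ↦ -y) = truncation ν k := by
    ext D hD
    rw [Measure.map_apply measurable_neg hD, truncation,
      Measure.restrict_apply (measurable_neg hD), Measure.restrict_apply hD,
      ← hν.symm _ (hD.inter (measurableSet_truncation k))]
    congr 1
    ext y
    simp
  have hsymm : charFun (truncation ν k) (-ξ) = charFun (truncation ν k) ξ := by
    conv_rhs => rw [← hneg, charFun_apply, integral_map (by fun_prop) (by fun_prop)]
    simp [charFun_apply]
  rw [charFun_neg] at hsymm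
  have hre : (charFun (truncation ν k) ξ).re
      = (truncation ν k).real Set.univ - Phi (truncation ν k) ξ := by
    have hint : ∀ f : EuclideanSpace ℝ (Fin d) → ℝ, Continuous f →
        Integrable (fun x ↦ Real.cos (f x)) (truncation ν k) := fun f hf ↦
      Integrable.of_bound (by fun_prop) 1 (ae_of_all _ fun x ↦ Real.abs_cos_le_one _)
    have hint' : Integrable (fun x : EuclideanSpace ℝ (Fin d) ↦
        Complex.exp (inner ℝ x ξ * Complex.I)) (truncation ν k) := by
      refine Integrable.of_bound (by fun_prop) 1 (ae_of_all _ fun x ↦ ?_)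
      rw [Complex.norm_exp_ofReal_mul_I]
    rw [Phi, integral_sub (integrable_const _) (hint _ (by fun_prop)), charFun_apply,
      ← RCLike.re_eq_complex_re, ← integral_re hint']
    simp only [RCLike.re_eq_complex_re, Complex.exp_ofReal_mul_I_re, integral_const, smul_eq_mul,
      mul_one, sub_sub_cancel, real_inner_comm]
  have h1 : charFun (truncation ν k) ξ = ((charFun (truncation ν k) ξ).re : ℂ) :=
    (Complex.conj_eq_iff_re.1 hsymm).symm
  rw [h1, hre]
  push_cast
  ring

theorem charFun_ofReal_smul {s : ℝ} (hs : 0 ≤ s) (μ : Measure (EuclideanSpace ℝ (Fin d)))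
    (ξ : EuclideanSpace ℝ (Fin d)) :
    charFun (ENNReal.ofReal s • μ) ξ - ((ENNReal.ofReal s • μ).real Set.univ : ℝ)
      = s * (charFun μ ξ - (μ.real Set.univ : ℝ)) := by
  rw [charFun_apply, integral_smul_measure, ← charFun_apply, measureReal_ennreal_smul_apply,
    ENNReal.toReal_ofReal hs, Complex.real_smul]
  push_cast
  ring

theorem IsSymmetricLevyMeasure.tendsto_charFun_compoundPoisson (hν : IsSymmetricLevyMeasure ν)
    {s : ℝ} (hs : 0 ≤ s) (ξ : EuclideanSpace ℝ (Fin d)) :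
    Tendsto (fun k ↦ charFun (compoundPoisson (ENNReal.ofReal s • truncation ν k)) ξ) atTop
      (𝓝 (Complex.exp (-(s : ℂ) * (Phi ν ξ : ℂ)))) := by
  have h1 : ∀ k, charFun (compoundPoisson (ENNReal.ofReal s • truncation ν k)) ξ
      = Complex.exp (-(s : ℂ) * (Phi (truncation ν k) ξ : ℂ)) := by
    intro k
    have := hν.isFiniteMeasure_truncation k
    have := Measure.smul_finite (truncation ν k) (c := ENNReal.ofReal s) ENNReal.ofReal_ne_top
    rw [charFun_compoundPoisson, charFun_ofReal_smul hs, hν.charFun_truncation]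
    ring_nf
  simp_rw [h1]
  have h2 := (Complex.continuous_ofReal.tendsto _).comp (hν.tendsto_Phi_truncation ξ)
  exact (Complex.continuous_exp.tendsto _).comp (h2.const_mul _)

end Exponent

/-! ### Domination under convolution and under weak limits -/

section OneStep

variable {E : Type*} [NormedAddCommGroup E] [InnerProductSpace ℝ E] [FiniteDimensional ℝ E]
  [MeasurableSpace E] [BorelSpace E]

/-- A shift by a vector of length less than `ρ` keeps `B(v, ρ)` inside `B(v, 2ρ)`, and `Q` gives
such shifts mass at least `1/2`. -/
theorem half_smul_restrict_ball_le_conv {Q : Measure E} [IsFiniteMeasure Q] {ρ : ℝ}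
    (hQ : 2⁻¹ ≤ Q (Metric.ball 0 ρ)) (v : E) :
    (2⁻¹ : ℝ≥0∞) • volume.restrict (Metric.ball v ρ)
      ≤ Measure.conv Q (volume.restrict (Metric.ball v (2 * ρ))) := by
  refine Measure.le_iff.2 fun s hs ↦ ?_
  rw [conv_apply _ _ hs, Measure.smul_apply, Measure.restrict_apply hs, smul_eq_mul]
  calc 2⁻¹ * volume (s ∩ Metric.ball v ρ)
      ≤ Q (Metric.ball 0 ρ) * volume (s ∩ Metric.ball v ρ) := by gcongr
    _ = ∫⁻ _ in Metric.ball 0 ρ, volume (s ∩ Metric.ball v ρ) ∂Q := by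
        rw [setLIntegral_const, mul_comm]
    _ ≤ ∫⁻ x in Metric.ball 0 ρ, volume.restrict (Metric.ball v (2 * ρ)) {y | x + y ∈ s} ∂Q := by
        refine setLIntegral_mono' measurableSet_ball fun x hx ↦ ?_
        have hm : MeasurableSet {y | x + y ∈ s} := measurableSet_preimage (by fun_prop) hs
        rw [Measure.restrict_apply hm,
          ← measure_preimage_add volume x (s ∩ Metric.ball v ρ)]
        refine measure_mono fun y hy ↦ ⟨hy.1, ?_⟩
        have h1 := hy.2
        rw [mem_ball_zero_iff] at hx
        rw [mem_ball_iff_norm] at h1 ⊢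
        have h2 := norm_sub_le (x + y - v) x
        have h3 : x + y - v - x = y - v := by abel
        rw [h3] at h2
        linarith
    _ ≤ ∫⁻ x, volume.restrict (Metric.ball v (2 * ρ)) {y | x + y ∈ s} ∂Q :=
        setLIntegral_le_lintegral _ _

/-- Inner regularity of `W` reduces the claim to compact sets, where the portmanteau inequality for
closed sets has the right direction. -/
theorem measure_le_of_tendsto {μ : ℕ → ProbabilityMeasure E} {μ₀ : ProbabilityMeasure E}
    (h : Tendsto μ atTop (𝓝 μ₀)) (W : Measure E) [IsFiniteMeasure W]
    (hW : ∀ᶠ k in atTop, W ≤ μ k) : W ≤ μ₀ := by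
  refine Measure.le_iff.2 fun s hs ↦ ?_
  rw [hs.measure_eq_iSup_isCompact_of_ne_top (measure_ne_top W s)]
  refine iSup₂_le fun K hKs ↦ iSup_le fun hK ↦ ?_
  have h1 := ProbabilityMeasure.limsup_measure_closed_le_of_tendsto h hK.isClosed
  refine le_trans ?_ (h1.trans (measure_mono hKs))
  refine le_trans ?_ (liminf_le_limsup)
  exact le_liminf_of_le (by isBoundedDefault) (hW.mono fun k hk ↦ hk K)

end OneStep

/-! ### Lower bound for `P s` at small times -/

section SmallTime

variable {d : ℕ} {ν : Measure (EuclideanSpace ℝ (Fin d))}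

instance isFiniteMeasure_restrict_ball (v : EuclideanSpace ℝ (Fin d)) (ρ : ℝ) :
    IsFiniteMeasure (volume.restrict (Metric.ball v ρ)) :=
  ⟨by simpa using measure_ball_lt_top⟩

theorem measure_smul_mono {a b : ℝ≥0∞} {μ μ' : Measure (EuclideanSpace ℝ (Fin d))}
    (hab : a ≤ b) (h : μ ≤ μ') : a • μ ≤ b • μ' := by
  refine Measure.le_iff.2 fun s _ ↦ ?_
  rw [Measure.smul_apply, Measure.smul_apply, smul_eq_mul, smul_eq_mul]
  exact mul_le_mul' hab (h s)

theorem smul_restrict_le_of_rnDeriv {κ r₀ : ℝ}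
    (hdens : ∀ᵐ y ∂(volume : Measure (EuclideanSpace ℝ (Fin d))),
      0 < ‖y‖ → ‖y‖ < r₀ → ENNReal.ofReal κ ≤ ν.rnDeriv volume y) :
    ENNReal.ofReal κ • (volume : Measure (EuclideanSpace ℝ (Fin d))).restrict
      {y | 0 < ‖y‖ ∧ ‖y‖ < r₀} ≤ ν := by
  have hD : MeasurableSet {y : EuclideanSpace ℝ (Fin d) | 0 < ‖y‖ ∧ ‖y‖ < r₀} :=
    (measurableSet_lt measurable_const measurable_norm).inter
      (measurableSet_lt measurable_norm measurable_const)
  refine le_trans (Measure.le_iff.2 fun s hs ↦ ?_) (Measure.withDensity_rnDeriv_le ν volume)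
  rw [Measure.smul_apply, Measure.restrict_apply hs, smul_eq_mul, withDensity_apply _ hs,
    ← setLIntegral_const]
  refine (setLIntegral_mono_ae' (hs.inter hD) ?_).trans
    (lintegral_mono_set Set.inter_subset_left)
  filter_upwards [hdens] with y hy hys
  exact hy hys.2.1 hys.2.2

/-- With `r₀ = 16ρ` and `4ρ ≤ |v| ≤ 8ρ`, the ball `B(v, 2ρ)` lies in `ρ < |y| < r₀`: the density
bound holds there, and truncation below `ρ` removes nothing. -/
theorem smul_restrict_ball_le_truncation {κ r₀ ρ : ℝ} (hρ : 16 * ρ = r₀) (hρ0 : 0 < ρ)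
    (hdens : ∀ᵐ y ∂(volume : Measure (EuclideanSpace ℝ (Fin d))),
      0 < ‖y‖ → ‖y‖ < r₀ → ENNReal.ofReal κ ≤ ν.rnDeriv volume y)
    {v : EuclideanSpace ℝ (Fin d)} (hv₁ : r₀ / 4 ≤ ‖v‖) (hv₂ : ‖v‖ ≤ r₀ / 2) {k : ℕ}
    (hk : 1 / ((k : ℝ) + 1) < ρ) :
    ENNReal.ofReal κ • volume.restrict (Metric.ball v (2 * ρ)) ≤ truncation ν k := by
  have h1 := Measure.restrict_mono (s := Metric.ball v (2 * ρ)) (le_refl _)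
    (smul_restrict_le_of_rnDeriv hdens)
  have hball : ∀ y ∈ Metric.ball v (2 * ρ), ρ < ‖y‖ ∧ ‖y‖ < r₀ := by
    intro y hy
    rw [mem_ball_iff_norm] at hy
    have h2 := norm_sub_norm_le v y
    have h3 := norm_sub_norm_le y v
    rw [norm_sub_rev] at h2
    constructor <;> linarith
  have hi : Metric.ball v (2 * ρ) ∩ {y | 0 < ‖y‖ ∧ ‖y‖ < r₀} = Metric.ball v (2 * ρ) :=
    Set.inter_eq_left.2 fun y hy ↦ ⟨hρ0.trans (hball y hy).1, (hball y hy).2⟩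
  rw [Measure.restrict_smul, Measure.restrict_restrict measurableSet_ball, hi] at h1
  exact h1.trans (Measure.restrict_mono (fun y hy ↦ hk.trans (hball y hy).1) le_rfl)

theorem measureReal_smul_restrict_ball {a ρ : ℝ} (ha : 0 ≤ a) (v : EuclideanSpace ℝ (Fin d)) :
    (ENNReal.ofReal a • volume.restrict (Metric.ball v ρ)).real Set.univ
      = a * volume.real (Metric.ball (0 : EuclideanSpace ℝ (Fin d)) ρ) := by
  rw [measureReal_ennreal_smul_apply, ENNReal.toReal_ofReal ha, measureReal_restrict_apply_univ,
    measureReal_def, measureReal_def, Measure.addHaar_ball_center]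

theorem norm_charFun_sub_measureReal_le (μ : Measure (EuclideanSpace ℝ (Fin d)))
    (ξ : EuclideanSpace ℝ (Fin d)) :
    ‖charFun μ ξ - (μ.real Set.univ : ℝ)‖ ≤ 2 * μ.real Set.univ := by
  refine (norm_sub_le _ _).trans ?_
  have h1 := norm_charFun_le (μ := μ) ξ
  rw [Complex.norm_real, Real.norm_of_nonneg measureReal_nonneg]
  linarith

/-- If the jump measure `L` dominates a multiple of Lebesgue measure on a ball, and the remaining
jumps move little, then the compound Poisson distribution dominates a multiple of Lebesgue measure
on a smaller ball. -/
theorem smul_restrict_le_compoundPoisson {ρ R ε : ℝ}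
    (hRε : ∀ Q : Measure (EuclideanSpace ℝ (Fin d)), IsProbabilityMeasure Q →
      (∀ ξ, ‖ξ‖ ≤ R → ‖1 - charFun Q ξ‖ ≤ ε) → 2⁻¹ ≤ Q (Metric.ball 0 ρ))
    {L : Measure (EuclideanSpace ℝ (Fin d))} [IsFiniteMeasure L] {a m : ℝ} (ha : 0 ≤ a)
    (hm : m = a * volume.real (Metric.ball (0 : EuclideanSpace ℝ (Fin d)) (2 * ρ)))
    {v : EuclideanSpace ℝ (Fin d)}
    (hL : ENNReal.ofReal a • volume.restrict (Metric.ball v (2 * ρ)) ≤ L) {δ : ℝ}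
    (hδ : ∀ ξ, ‖ξ‖ ≤ R → ‖charFun L ξ - (L.real Set.univ : ℝ)‖ ≤ δ)
    (h1 : δ + 2 * m ≤ 1) (hε : 2 * (δ + 2 * m) ≤ ε) :
    ENNReal.ofReal (2⁻¹ * Real.exp (-m) * a) • volume.restrict (Metric.ball v ρ)
      ≤ compoundPoisson L := by
  set M := ENNReal.ofReal a • volume.restrict (Metric.ball v (2 * ρ)) with hM
  have hMfin : IsFiniteMeasure M := Measure.smul_finite _ ENNReal.ofReal_ne_top
  have hMm : M.real Set.univ = m := by rw [hM, measureReal_smul_restrict_ball ha, hm]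
  -- Independent splitting: `M` supplies the single large jump, `L - M` supplies the small
  -- displacement.
  have hLM : L - M + M = L := Measure.sub_add_cancel_of_le hL
  have hlfin : IsFiniteMeasure (L - M) := inferInstance
  have hQ : 2⁻¹ ≤ compoundPoisson (L - M) (Metric.ball 0 ρ) := by
    refine hRε _ inferInstance fun ξ hξ ↦ ?_
    have e1 : charFun (L - M) ξ - ((L - M).real Set.univ : ℝ)
        = (charFun L ξ - (L.real Set.univ : ℝ)) - (charFun M ξ - (M.real Set.univ : ℝ)) := by
      have e3 := charFun_add_measure (L - M) M ξ
      have e4 := measureReal_add_apply (μ₁ := L - M) (μ₂ := M) (s := Set.univ)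
      rw [hLM] at e3 e4
      rw [e3, e4]
      push_cast
      ring
    have e2 : ‖charFun (L - M) ξ - ((L - M).real Set.univ : ℝ)‖ ≤ δ + 2 * m := by
      rw [e1]
      refine (norm_sub_le _ _).trans (add_le_add (hδ ξ hξ) ?_)
      rw [← hMm]
      exact norm_charFun_sub_measureReal_le M ξ
    rw [charFun_compoundPoisson, norm_sub_rev]
    refine (Complex.norm_exp_sub_one_le (e2.trans h1)).trans ?_
    linarith
  have h2 : Measure.conv (compoundPoisson (L - M)) (ENNReal.ofReal (Real.exp (-m)) • M)
      ≤ compoundPoisson L := by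
    conv_rhs => rw [← hLM, compoundPoisson_add]
    have := Measure.smul_finite M (c := ENNReal.ofReal (Real.exp (-m))) ENNReal.ofReal_ne_top
    refine conv_mono le_rfl ?_
    rw [← hMm]
    exact smul_le_compoundPoisson M
  refine le_trans ?_ h2
  rw [hM, smul_smul, Measure.conv_smul_right, mul_comm 2⁻¹, mul_right_comm, ENNReal.ofReal_mul
    (by positivity), ENNReal.ofReal_mul (by positivity), ← smul_smul,
    ENNReal.ofReal_inv_of_pos (by norm_num), ENNReal.ofReal_ofNat]
  have h3 := half_smul_restrict_ball_le_conv hQ v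
  exact measure_smul_mono le_rfl h3

theorem exists_smul_restrict_ball_le (hν : IsSymmetricLevyMeasure ν)
    {P : ℝ → Measure (EuclideanSpace ℝ (Fin d))} (hP : IsLevySemigroup ν P)
    {κ r₀ ρ : ℝ} (hρ : 16 * ρ = r₀) (hρ0 : 0 < ρ) (hκ : 0 < κ)
    (hdens : ∀ᵐ y ∂(volume : Measure (EuclideanSpace ℝ (Fin d))),
      0 < ‖y‖ → ‖y‖ < r₀ → ENNReal.ofReal κ ≤ ν.rnDeriv volume y) :
    ∃ T > 0, ∃ c > 0, ∀ s, 0 < s → s ≤ T → ∀ v : EuclideanSpace ℝ (Fin d),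
      r₀ / 4 ≤ ‖v‖ → ‖v‖ ≤ r₀ / 2 →
        ENNReal.ofReal (c * s) • volume.restrict (Metric.ball v ρ) ≤ P s := by
  obtain ⟨R, hR, ε, hε, hRε⟩ :=
    half_le_measure_ball_of_charFun (E := EuclideanSpace ℝ (Fin d)) hρ0
  set K := ∫ y, min 1 (‖y‖ ^ 2) ∂ν with hK
  have hK0 : 0 ≤ K := integral_nonneg fun y ↦ by positivity
  set m := κ * volume.real (Metric.ball (0 : EuclideanSpace ℝ (Fin d)) (2 * ρ)) with hm
  have hm0 : 0 ≤ m := by positivity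
  set C := (2 + R ^ 2) * K + 2 * m + 1 with hC
  have hC1 : 1 ≤ C := by
    have : 0 ≤ (2 + R ^ 2) * K := by positivity
    linarith
  have hC0 : 0 < C := by linarith
  -- For `s ≤ T`, `s C` bounds the exponent of the residual law on `‖ξ‖ ≤ R`, so that law is close
  -- enough to `δ₀`. The bound `Φ_k ≤ Φ ≤ (2 + R²) K` makes `T` independent of `k`; the summand `1`
  -- in `C` gives `s ≤ 1`.
  have hT : 0 < min 1 (ε / 2) / C := div_pos (lt_min one_pos (half_pos hε)) hC0
  refine ⟨min 1 (ε / 2) / C, hT, 2⁻¹ * Real.exp (-m) * κ, by positivity,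
    fun s hs hsT v hv₁ hv₂ ↦ ?_⟩
  rw [le_div_iff₀ hC0] at hsT
  have hs1 : s * C ≤ 1 := hsT.trans (min_le_left _ _)
  have hsε : s * C ≤ ε / 2 := hsT.trans (min_le_right _ _)
  have hfin := hν.isFiniteMeasure_truncation
  have hLfin : ∀ k, IsFiniteMeasure (ENNReal.ofReal s • truncation ν k) := fun k ↦
    Measure.smul_finite _ ENNReal.ofReal_ne_top
  obtain ⟨hPs, hPchar⟩ := hP s hs.le
  let μs : ℕ → ProbabilityMeasure (EuclideanSpace ℝ (Fin d)) := fun k ↦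
    ⟨compoundPoisson (ENNReal.ofReal s • truncation ν k), inferInstance⟩
  let μ₀ : ProbabilityMeasure (EuclideanSpace ℝ (Fin d)) := ⟨P s, hPs⟩
  have hlim : Tendsto μs atTop (𝓝 μ₀) := by
    refine ProbabilityMeasure.tendsto_of_tendsto_charFun fun ξ ↦ ?_
    change Tendsto (fun k ↦ charFun (compoundPoisson (ENNReal.ofReal s • truncation ν k)) ξ) atTop
      (𝓝 (charFun (P s) ξ))
    rw [hPchar]
    exact hν.tendsto_charFun_compoundPoisson hs.le ξ
  have hWfin : IsFiniteMeasure (ENNReal.ofReal (2⁻¹ * Real.exp (-m) * κ * s) •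
      (volume : Measure (EuclideanSpace ℝ (Fin d))).restrict (Metric.ball v ρ)) :=
    Measure.smul_finite _ ENNReal.ofReal_ne_top
  refine measure_le_of_tendsto hlim _ ?_
  have hev : ∀ᶠ k : ℕ in atTop, 1 / ((k : ℝ) + 1) < ρ :=
    tendsto_one_div_add_atTop_nhds_zero_nat.eventually_lt_const hρ0
  filter_upwards [hev] with k hk
  change _ ≤ compoundPoisson (ENNReal.ofReal s • truncation ν k)
  have hL : ENNReal.ofReal (s * κ) • volume.restrict (Metric.ball v (2 * ρ))
      ≤ ENNReal.ofReal s • truncation ν k := by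
    rw [ENNReal.ofReal_mul hs.le, ← smul_smul]
    exact measure_smul_mono le_rfl
      (smul_restrict_ball_le_truncation hρ hρ0 hdens hv₁ hv₂ hk)
  have h := smul_restrict_le_compoundPoisson (m := s * m) (δ := s * ((2 + R ^ 2) * K)) hRε
    (by positivity) (by rw [hm]; ring) hL (fun ξ hξ ↦ ?_) (by nlinarith) (by nlinarith)
  · refine le_trans (measure_smul_mono (ENNReal.ofReal_le_ofReal ?_) le_rfl) h
    have hsm : s * m ≤ m := by
      have : s ≤ 1 := by nlinarith
      nlinarith
    have hexp : Real.exp (-m) ≤ Real.exp (-(s * m)) := Real.exp_le_exp.2 (by linarith)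
    calc 2⁻¹ * Real.exp (-m) * κ * s = 2⁻¹ * Real.exp (-m) * (s * κ) := by ring
      _ ≤ 2⁻¹ * Real.exp (-(s * m)) * (s * κ) := by gcongr
  · rw [charFun_ofReal_smul hs.le, hν.charFun_truncation, norm_mul, norm_neg, Complex.norm_real,
      Complex.norm_real, Real.norm_of_nonneg hs.le, Real.norm_of_nonneg (Phi_nonneg _ _)]
    refine mul_le_mul_of_nonneg_left ?_ hs.le
    refine ((hν.Phi_truncation_le k ξ).trans (hν.Phi_le ξ)).trans ?_
    refine mul_le_mul_of_nonneg_right ?_ hK0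
    have := pow_le_pow_left₀ (norm_nonneg ξ) hξ 2
    linarith

end SmallTime

/-! ### Chaining through the semigroup, and passage to densities -/

section Chaining

variable {d : ℕ} {ν : Measure (EuclideanSpace ℝ (Fin d))}
  {P : ℝ → Measure (EuclideanSpace ℝ (Fin d))}

/-- At `z ∈ B(v + w, ρ)` the convolution has density `|B(v, ρ) ∩ B(z - w, ρ)|`. The two centres are
less than `ρ` apart, so the intersection contains the ball of radius `ρ/2` about their midpoint. -/
theorem smul_restrict_ball_le_conv_restrict_ball (v w : EuclideanSpace ℝ (Fin d)) (ρ : ℝ) :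
    volume (Metric.ball (0 : EuclideanSpace ℝ (Fin d)) (ρ / 2)) •
        volume.restrict (Metric.ball (v + w) ρ)
      ≤ Measure.conv (volume.restrict (Metric.ball v ρ)) (volume.restrict (Metric.ball w ρ)) := by
  refine Measure.le_iff.2 fun s hs ↦ ?_
  rw [conv_apply _ _ hs, Measure.smul_apply, Measure.restrict_apply hs, smul_eq_mul]
  have hS : MeasurableSet {p : EuclideanSpace ℝ (Fin d) × EuclideanSpace ℝ (Fin d) |
      ‖p.2 - (p.1 + w)‖ < ρ} := (isOpen_lt (by fun_prop) continuous_const).measurableSet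
  have h1 : ∀ x : EuclideanSpace ℝ (Fin d),
      volume.restrict (Metric.ball w ρ) {y | x + y ∈ s}
        = ∫⁻ z in s, {p : EuclideanSpace ℝ (Fin d) × EuclideanSpace ℝ (Fin d) |
            ‖p.2 - (p.1 + w)‖ < ρ}.indicator (fun _ ↦ (1 : ℝ≥0∞)) (x, z) := by
    intro x
    have hm : MeasurableSet {y | x + y ∈ s} := measurableSet_preimage (by fun_prop) hs
    have hx : MeasurableSet {z : EuclideanSpace ℝ (Fin d) | ‖z - (x + w)‖ < ρ} :=
      (isOpen_lt (by fun_prop) continuous_const).measurableSet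
    have e : ∀ z, {p : EuclideanSpace ℝ (Fin d) × EuclideanSpace ℝ (Fin d) |
            ‖p.2 - (p.1 + w)‖ < ρ}.indicator (fun _ ↦ (1 : ℝ≥0∞)) (x, z)
        = {z : EuclideanSpace ℝ (Fin d) | ‖z - (x + w)‖ < ρ}.indicator (fun _ ↦ 1) z :=
      fun z ↦ rfl
    simp_rw [e]
    rw [lintegral_indicator_const hx, one_mul, Measure.restrict_apply hm,
      Measure.restrict_apply hx, Set.inter_comm _ s,
      ← measure_preimage_add volume x (s ∩ {z | ‖z - (x + w)‖ < ρ})]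
    congr 1
    ext y
    simp only [Set.mem_inter_iff, Set.mem_ofPred_eq, Set.mem_preimage, mem_ball_iff_norm,
      add_sub_add_left_eq_sub]
  simp_rw [h1]
  rw [lintegral_lintegral_swap]
  · calc volume (Metric.ball (0 : EuclideanSpace ℝ (Fin d)) (ρ / 2)) *
          volume (s ∩ Metric.ball (v + w) ρ)
        = ∫⁻ _ in s ∩ Metric.ball (v + w) ρ,
            volume (Metric.ball (0 : EuclideanSpace ℝ (Fin d)) (ρ / 2)) := by
          rw [setLIntegral_const]
      _ ≤ ∫⁻ z in s ∩ Metric.ball (v + w) ρ, ∫⁻ x in Metric.ball v ρ,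
            {p : EuclideanSpace ℝ (Fin d) × EuclideanSpace ℝ (Fin d) |
            ‖p.2 - (p.1 + w)‖ < ρ}.indicator (fun _ ↦ (1 : ℝ≥0∞)) (x, z) := by
          refine setLIntegral_mono' (hs.inter measurableSet_ball) fun z hz ↦ ?_
          have hx : MeasurableSet {x : EuclideanSpace ℝ (Fin d) | ‖z - (x + w)‖ < ρ} :=
            (isOpen_lt (by fun_prop) continuous_const).measurableSet
          have e : ∀ x, {p : EuclideanSpace ℝ (Fin d) × EuclideanSpace ℝ (Fin d) |
              ‖p.2 - (p.1 + w)‖ < ρ}.indicator (fun _ ↦ (1 : ℝ≥0∞)) (x, z)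
              = {x : EuclideanSpace ℝ (Fin d) | ‖z - (x + w)‖ < ρ}.indicator (fun _ ↦ 1) x :=
            fun x ↦ rfl
          simp_rw [e]
          rw [lintegral_indicator_const hx, one_mul, Measure.restrict_apply hx,
            ← Measure.addHaar_ball_center volume ((2⁻¹ : ℝ) • (v + (z - w)))]
          have hzv := hz.2
          rw [mem_ball_iff_norm] at hzv
          refine measure_mono fun y hy ↦ ?_
          rw [mem_ball_iff_norm] at hy
          have hhalf : ‖(2⁻¹ : ℝ) • (z - (v + w))‖ < ρ / 2 := by
            rw [norm_smul, Real.norm_of_nonneg (by norm_num)]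
            linarith
          constructor
          · change ‖z - (y + w)‖ < ρ
            have e2 : z - (y + w) = (2⁻¹ : ℝ) • (z - (v + w)) -
                (y - (2⁻¹ : ℝ) • (v + (z - w))) := by module
            rw [e2]
            linarith [norm_sub_le ((2⁻¹ : ℝ) • (z - (v + w))) (y - (2⁻¹ : ℝ) • (v + (z - w)))]
          · rw [mem_ball_iff_norm]
            have e2 : y - v = (2⁻¹ : ℝ) • (z - (v + w)) +
                (y - (2⁻¹ : ℝ) • (v + (z - w))) := by module
            rw [e2]
            linarith [norm_add_le ((2⁻¹ : ℝ) • (z - (v + w))) (y - (2⁻¹ : ℝ) • (v + (z - w)))]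
      _ ≤ _ := lintegral_mono_set Set.inter_subset_left
  · exact (measurable_const.indicator hS).aemeasurable

theorem IsLevySemigroup.add (hP : IsLevySemigroup ν P) {s t : ℝ} (hs : 0 ≤ s) (ht : 0 ≤ t) :
    P (s + t) = Measure.conv (P s) (P t) := by
  obtain ⟨_, h1⟩ := hP s hs
  obtain ⟨_, h2⟩ := hP t ht
  obtain ⟨_, h3⟩ := hP (s + t) (add_nonneg hs ht)
  refine Measure.ext_of_charFun (funext fun ξ ↦ ?_)
  rw [charFun_conv, h1, h2, h3, ← Complex.exp_add]
  push_cast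
  ring_nf

/-- `n + 1` steps give `n + 1` factors `a`, but only `n` convolutions, each costing one ball volume.
The radius does not shrink along the chain. -/
theorem IsLevySemigroup.smul_restrict_ball_le (hP : IsLevySemigroup ν P) {s a ρ : ℝ} (hs : 0 ≤ s)
    {v : EuclideanSpace ℝ (Fin d)} (ha : 0 ≤ a)
    (h : ENNReal.ofReal a • volume.restrict (Metric.ball v ρ) ≤ P s) (n : ℕ) :
    ENNReal.ofReal (a * (a * volume.real (Metric.ball (0 : EuclideanSpace ℝ (Fin d)) (ρ / 2))) ^ n)
        • volume.restrict (Metric.ball (((n : ℝ) + 1) • v) ρ) ≤ P (((n : ℝ) + 1) * s) := by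
  induction n with
  | zero => simpa using h
  | succ n ih =>
    have hn : (((n + 1 : ℕ) : ℝ) + 1) = ((n : ℝ) + 1) + 1 := by push_cast; ring
    rw [hn, add_mul ((n : ℝ) + 1) 1 s, add_smul ((n : ℝ) + 1) 1 v, one_mul, one_smul,
      hP.add (by positivity) hs]
    obtain ⟨_, -⟩ := hP s hs
    obtain ⟨_, -⟩ := hP (((n : ℝ) + 1) * s) (by positivity)
    set q := volume.real (Metric.ball (0 : EuclideanSpace ℝ (Fin d)) (ρ / 2)) with hq
    have hq0 : 0 ≤ q := measureReal_nonneg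
    have f1 := Measure.smul_finite (volume.restrict (Metric.ball (((n : ℝ) + 1) • v) ρ))
      (c := ENNReal.ofReal (a * (a * q) ^ n)) ENNReal.ofReal_ne_top
    have f2 := Measure.smul_finite (volume.restrict (Metric.ball v ρ))
      (c := ENNReal.ofReal a) ENNReal.ofReal_ne_top
    refine le_trans ?_ (conv_mono ih h)
    rw [Measure.conv_smul_right, Measure.conv_smul_left, smul_smul]
    have e : ENNReal.ofReal (a * (a * q) ^ (n + 1))
        = ENNReal.ofReal a * ENNReal.ofReal (a * (a * q) ^ n) *
          volume (Metric.ball (0 : EuclideanSpace ℝ (Fin d)) (ρ / 2)) := by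
      rw [← ofReal_measureReal (measure_ball_lt_top.ne), ← hq, ← ENNReal.ofReal_mul ha,
        ← ENNReal.ofReal_mul (by positivity)]
      congr 1
      ring
    rw [e, ← smul_smul]
    exact measure_smul_mono le_rfl (smul_restrict_ball_le_conv_restrict_ball _ _ _)

theorem le_density_of_smul_restrict_ball_le {p : EuclideanSpace ℝ (Fin d) → ℝ} (hp : Continuous p)
    {K ρ : ℝ} (hρ : 0 < ρ) (hK : 0 < K) {x : EuclideanSpace ℝ (Fin d)}
    (h : ENNReal.ofReal K • volume.restrict (Metric.ball x ρ)
      ≤ volume.withDensity fun y ↦ ENNReal.ofReal (p y)) : K ≤ p x := by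
  by_contra! hlt
  -- `K'` is also kept positive so that `ENNReal.ofReal` reflects the order in the final comparison.
  obtain ⟨K', hK', hK'K⟩ := exists_between (max_lt hlt hK)
  obtain ⟨δ, hδ, hball⟩ := Metric.isOpen_iff.1 (isOpen_lt hp continuous_const) x
    (show p x < K' from (le_max_left _ _).trans_lt hK')
  set B := Metric.ball x (min δ ρ) with hB
  have hBpos : volume B ≠ 0 := (Metric.measure_ball_pos _ _ (lt_min hδ hρ)).ne'
  have hBfin : volume B ≠ ∞ := measure_ball_lt_top.ne
  have h1 := h B
  rw [Measure.smul_apply, Measure.restrict_apply measurableSet_ball, smul_eq_mul,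
    Set.inter_eq_left.2 (Metric.ball_subset_ball (min_le_right _ _)),
    withDensity_apply _ measurableSet_ball] at h1
  have h2 : ∫⁻ y in B, ENNReal.ofReal (p y) ≤ ENNReal.ofReal K' * volume B := by
    rw [← setLIntegral_const]
    refine setLIntegral_mono' measurableSet_ball fun y hy ↦ ENNReal.ofReal_le_ofReal ?_
    exact le_of_lt (hball (Metric.ball_subset_ball (min_le_left _ _) hy))
  have h3 := (ENNReal.mul_le_mul_iff_left hBpos hBfin).1 (h1.trans h2)
  rw [ENNReal.ofReal_le_ofReal_iff ((le_max_right _ _).trans hK'.le)] at h3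
  linarith

theorem integrable_charFun (hP : IsLevySemigroup ν P) {M₀ : ℝ} {tp : ℝ≥0∞}
    (hA : ExponentIntegralCondition ν M₀ tp) {t : ℝ} (ht : 0 < t) : Integrable (charFun (P t)) := by
  obtain ⟨-, htp, hA⟩ := hA
  obtain ⟨t₀, ht₀, ht₀p⟩ : ∃ t₀ : ℝ, 0 < t₀ ∧ ENNReal.ofReal t₀ < tp := by
    obtain ⟨r, hr0, hr⟩ := ENNReal.lt_iff_exists_nnreal_btwn.1 htp
    exact ⟨r, by simpa using hr0, by simpa using hr⟩
  have h1 := hA (min t t₀) (lt_min ht ht₀)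
    ((ENNReal.ofReal_le_ofReal (min_le_right _ _)).trans_lt ht₀p)
  obtain ⟨_, hchar⟩ := hP t ht.le
  refine ⟨by fun_prop, ?_⟩
  -- The unit ball contributes at most its volume. Outside it `1 ≤ ‖ξ‖`, and lowering the time to
  -- `min t t₀` only increases the exponential, so times beyond `tp` are covered too.
  calc ∫⁻ ξ, ‖charFun (P t) ξ‖ₑ
      ≤ ∫⁻ ξ, ((Metric.ball (0 : EuclideanSpace ℝ (Fin d)) 1).indicator (fun _ ↦ 1) ξ +
          ENNReal.ofReal (Real.exp (-min t t₀ * Phi ν ξ) * ‖ξ‖)) := by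
        refine lintegral_mono fun ξ ↦ ?_
        by_cases hξ : ξ ∈ Metric.ball (0 : EuclideanSpace ℝ (Fin d)) 1
        · rw [Set.indicator_of_mem hξ]
          refine le_trans ?_ le_self_add
          rw [← ofReal_norm, ← ENNReal.ofReal_one]
          exact ENNReal.ofReal_le_ofReal (norm_charFun_le_one ξ)
        · refine le_trans ?_ le_add_self
          rw [← ofReal_norm, hchar, Complex.norm_exp]
          refine ENNReal.ofReal_le_ofReal ?_
          have e : (-(t : ℂ) * (Phi ν ξ : ℂ)).re = -t * Phi ν ξ := by
            rw [← Complex.ofReal_neg, ← Complex.ofReal_mul, Complex.ofReal_re]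
          rw [e]
          have h2 : 1 ≤ ‖ξ‖ := by simpa using hξ
          have h3 : Real.exp (-t * Phi ν ξ) ≤ Real.exp (-min t t₀ * Phi ν ξ) := by
            refine Real.exp_le_exp.2 (mul_le_mul_of_nonneg_right ?_ (Phi_nonneg _ _))
            linarith [min_le_left t t₀]
          nlinarith [Real.exp_pos (-min t t₀ * Phi ν ξ)]
    _ = volume (Metric.ball (0 : EuclideanSpace ℝ (Fin d)) 1) +
          ∫⁻ ξ, ENNReal.ofReal (Real.exp (-min t t₀ * Phi ν ξ) * ‖ξ‖) := by
        rw [lintegral_add_left (measurable_const.indicator measurableSet_ball),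
          lintegral_indicator_const measurableSet_ball, one_mul]
    _ < ∞ := ENNReal.add_lt_top.2 ⟨measure_ball_lt_top, h1.trans_lt ENNReal.ofReal_lt_top⟩

theorem exists_isTransitionDensity (hP : IsLevySemigroup ν P) {M₀ : ℝ} {tp : ℝ≥0∞}
    (hA : ExponentIntegralCondition ν M₀ tp) :
    ∃ p : ℝ → EuclideanSpace ℝ (Fin d) → ℝ, IsTransitionDensity P p := by
  have h : ∀ t : ℝ, ∃ p : EuclideanSpace ℝ (Fin d) → ℝ, 0 < t → Continuous p ∧ (∀ x, 0 ≤ p x) ∧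
      P t = volume.withDensity fun x ↦ ENNReal.ofReal (p x) := by
    intro t
    by_cases ht : 0 < t
    · obtain ⟨_, -⟩ := hP t ht.le
      obtain ⟨p, hp⟩ :=
        exists_continuous_density_of_integrable_charFun (P t) (integrable_charFun hP hA ht)
      exact ⟨p, fun _ ↦ hp⟩
    · exact ⟨0, fun h ↦ absurd h ht⟩
  choose p hp using h
  exact ⟨p, hp⟩

theorem exp_neg_mul_log_le_pow {u r X : ℝ} {n : ℕ} (hu : 0 < u) (hu1 : u ≤ 1) (hn : n ≤ r)
    (hX : X = u⁻¹) : Real.exp (-r * Real.log X) ≤ u ^ n := by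
  have hlog : 0 ≤ Real.log X := by
    rw [hX]
    exact Real.log_nonneg (one_le_inv_iff₀.2 ⟨hu, hu1⟩)
  calc Real.exp (-r * Real.log X) ≤ Real.exp (n * -Real.log X) := by
        refine Real.exp_le_exp.2 ?_
        nlinarith
    _ = u ^ n := by rw [hX, Real.log_inv, neg_neg, Real.exp_nat_mul, Real.exp_log hu]

end Chaining

end

end LevyDensity

/-! ### Choice of the number of steps and of the constants -/

theorem theorem2 (d : ℕ) (hd : 1 ≤ d)
    (ν : Measure (EuclideanSpace ℝ (Fin d)))
    (hν : LevyDensity.IsSymmetricLevyMeasure ν) (hν_inf : ν Set.univ = ∞)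
    (P : ℝ → Measure (EuclideanSpace ℝ (Fin d))) (hP : LevyDensity.IsLevySemigroup ν P)
    (M₀ : ℝ) (tp : ℝ≥0∞) (hA : LevyDensity.ExponentIntegralCondition ν M₀ tp)
    (r₀ : ℝ) (hr₀ : 0 < r₀)
    (hdens : ∃ κ₀ : ℝ, 0 < κ₀ ∧ ∀ᵐ y ∂(volume : Measure (EuclideanSpace ℝ (Fin d))),
      0 < ‖y‖ → ‖y‖ < r₀ → ENNReal.ofReal κ₀ ≤ ν.rnDeriv volume y) :
    ∃ p : ℝ → EuclideanSpace ℝ (Fin d) → ℝ, LevyDensity.IsTransitionDensity P p ∧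
      ∃ c₁ c₂ c₃ c₄ : ℝ, 0 < c₁ ∧ 0 < c₂ ∧ 0 < c₃ ∧ 0 < c₄ ∧
        ∀ (t : ℝ) (x : EuclideanSpace ℝ (Fin d)), 0 < t → ENNReal.ofReal t < tp →
          max r₀ (c₄ * t) ≤ ‖x‖ →
          c₁ * Real.exp (-c₂ * ‖x‖ * Real.log (c₃ * ‖x‖ / t)) ≤ p t x := by
  obtain ⟨p, hp⟩ := LevyDensity.exists_isTransitionDensity hP hA
  obtain ⟨κ, hκ, hdens⟩ := hdens
  obtain ⟨ρ, hρ⟩ : ∃ ρ, 16 * ρ = r₀ := ⟨r₀ / 16, by ring⟩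
  have hρ0 : 0 < ρ := by linarith
  obtain ⟨T, hT, c, hc, hstep⟩ :=
    LevyDensity.exists_smul_restrict_ball_le hν hP hρ hρ0 hκ hdens
  obtain ⟨q, hq⟩ : ∃ q, q = volume.real (Metric.ball (0 : EuclideanSpace ℝ (Fin d)) (ρ / 2)) :=
    ⟨_, rfl⟩
  have hq0 : 0 < q := by
    rw [hq]
    exact ENNReal.toReal_pos (Metric.measure_ball_pos _ _ (by positivity)).ne'
      measure_ball_lt_top.ne
  -- `b ≤ c q` bounds the factor per step from below; `b ≤ 3/(2T)` makes `u = b r₀ t/(3|x|)` at most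
  -- `1`, so that raising the exponent only decreases its powers.
  obtain ⟨b, hb0, hbq, hbT⟩ : ∃ b > 0, b ≤ c * q ∧ b ≤ 3 / (2 * T) :=
    ⟨min (c * q) (3 / (2 * T)), lt_min (by positivity) (by positivity), min_le_left _ _,
      min_le_right _ _⟩
  -- `c₁` absorbs the one surplus `q` in the power `n + 1`, `c₂` comes from `n + 1 ≤ 3|x|/r₀`,
  -- `c₃|x|/t` is `u⁻¹`, and `c₄` forces the step time to be at most `T`.
  refine ⟨p, hp, q⁻¹, 3 / r₀, 3 / (b * r₀), r₀ / (2 * T), by positivity, by positivity,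
    by positivity, by positivity, fun t x ht _ hx ↦ ?_⟩
  have hxr : r₀ ≤ ‖x‖ := (le_max_left _ _).trans hx
  have hxt : r₀ / (2 * T) * t ≤ ‖x‖ := (le_max_right _ _).trans hx
  have hx0 : 0 < ‖x‖ := hr₀.trans_le hxr
  have hxt' : r₀ * t ≤ 2 * T * ‖x‖ := by
    rw [div_mul_eq_mul_div, div_le_iff₀ (by positivity)] at hxt
    linarith
  -- `n + 1 = ⌈2|x|/r₀⌉`, so each step has length between `r₀/3` and `r₀/2`; the upper bound on `n +
  -- 1` uses `r₀ ≤ |x|`.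
  obtain ⟨n, hn1, hn2⟩ : ∃ n : ℕ, 2 * ‖x‖ ≤ ((n : ℝ) + 1) * r₀ ∧ ((n : ℝ) + 1) * r₀ ≤ 3 * ‖x‖ := by
    have h1 : 0 < ⌈2 * ‖x‖ / r₀⌉₊ := Nat.ceil_pos.2 (by positivity)
    obtain ⟨n, hn⟩ := Nat.exists_eq_succ_of_ne_zero h1.ne'
    have h2 := Nat.le_ceil (2 * ‖x‖ / r₀)
    have h3 := Nat.ceil_lt_add_one (a := 2 * ‖x‖ / r₀) (by positivity)
    rw [hn] at h2 h3
    push_cast at h2 h3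
    refine ⟨n, (div_le_iff₀ hr₀).1 h2, ?_⟩
    have h4 : (n : ℝ) < 2 * ‖x‖ / r₀ := by linarith
    rw [lt_div_iff₀ hr₀] at h4
    linarith
  have hN : (0 : ℝ) < (n : ℝ) + 1 := by positivity
  have hv : ‖((n : ℝ) + 1)⁻¹ • x‖ = ‖x‖ / ((n : ℝ) + 1) := by
    rw [norm_smul, Real.norm_of_nonneg (by positivity), inv_mul_eq_div]
  have hsT : t / ((n : ℝ) + 1) ≤ T := by
    rw [div_le_iff₀ hN]
    have : r₀ * t ≤ r₀ * (T * ((n : ℝ) + 1)) := by nlinarith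
    exact le_of_mul_le_mul_left this hr₀
  have hs0 : 0 < t / ((n : ℝ) + 1) := by positivity
  have h1 := hstep (t / ((n : ℝ) + 1)) hs0 hsT (((n : ℝ) + 1)⁻¹ • x)
    (by rw [hv, div_le_div_iff₀ (by norm_num) hN]; nlinarith)
    (by rw [hv, div_le_div_iff₀ hN (by norm_num)]; nlinarith)
  have h2 := hP.smul_restrict_ball_le hs0.le (by positivity) h1 n
  rw [smul_inv_smul₀ hN.ne', mul_div_cancel₀ _ hN.ne', (hp t ht).2.2, ← hq] at h2
  refine le_trans ?_ (LevyDensity.le_density_of_smul_restrict_ball_le (hp t ht).1 hρ0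
    (by positivity) h2)
  have hu : b * r₀ * t / (3 * ‖x‖) ≤ c * (t / ((n : ℝ) + 1)) * q := by
    calc b * r₀ * t / (3 * ‖x‖) ≤ b * r₀ * t / (((n : ℝ) + 1) * r₀) := by gcongr
      _ = b * (t / ((n : ℝ) + 1)) := by field_simp
      _ ≤ c * q * (t / ((n : ℝ) + 1)) := by gcongr
      _ = c * (t / ((n : ℝ) + 1)) * q := by ring
  have hu1 : b * r₀ * t / (3 * ‖x‖) ≤ 1 := by
    rw [div_le_one (by positivity)]
    rw [le_div_iff₀ (by positivity)] at hbT
    nlinarith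
  have h3 : Real.exp (-(3 / r₀ * ‖x‖) * Real.log (3 / (b * r₀) * ‖x‖ / t))
      ≤ (b * r₀ * t / (3 * ‖x‖)) ^ (n + 1) := by
    refine LevyDensity.exp_neg_mul_log_le_pow (by positivity) hu1 ?_ ?_
    · rw [div_mul_eq_mul_div, le_div_iff₀ hr₀]
      push_cast
      exact hn2
    · rw [inv_div]
      field_simp
  calc q⁻¹ * Real.exp (-(3 / r₀) * ‖x‖ * Real.log (3 / (b * r₀) * ‖x‖ / t))
      = q⁻¹ * Real.exp (-(3 / r₀ * ‖x‖) * Real.log (3 / (b * r₀) * ‖x‖ / t)) := by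
        rw [neg_mul (3 / r₀) ‖x‖]
    _ ≤ q⁻¹ * (c * (t / ((n : ℝ) + 1)) * q) ^ (n + 1) := by
        refine mul_le_mul_of_nonneg_left (h3.trans ?_) (by positivity)
        exact pow_le_pow_left₀ (by positivity) hu _
    _ = c * (t / ((n : ℝ) + 1)) * (c * (t / ((n : ℝ) + 1)) * q) ^ n := by
        rw [pow_succ]
        field_simp
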